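/- Let $[n]=\{1,\dots,n\}$. A distribution over $[n]$ is a function $D:[n]\to[0,1]$ with $\sum_{i}D(i)=1$, and the distance of two distributions is $\|D-D'\|_1=\sum_{i}|D(i)-D'(i)|$. A property $\mathcal P$ over $[n]$ is a topologically closed set of distributions over $[n]$. It is label-invariant if $D\in\mathcal P$ implies $D\circ\sigma^{-1}\in\mathcal P$ for every permutation $\sigma$ of $[n]$. A distribution $D$ is $\eta$-close to $\mathcal P$ if $\inf_{D'\in\mathcal P}\|D-D'\|_1\le\eta$ and $\varepsilon$-far from $\mathcal P$ if $\inf_{D'\in\mathcal P}\|D-D'\|_1\ge\varepsilon$ (with $\inf\emptyset=+\infty$). For $0\le\eta<\varepsilon\le 2$, an $(\eta,\varepsilon)$-tester for $\mathcal P$ with $s$ samples is a randomized algorithm that receives $s$ independent samples from an unknown distribution $D$ over $[n]$ and that accepts with probability at least $2/3$ whenever $D$ is $\eta$-close to $\mathcal P$, and rejects with probability at least $2/3$ whenever $D$ is $\varepsilon$-far from $\mathcal P$. **Theorem.** There is an absolute constant $C>0$ such that the following holds for every $n$, every label-invariant property $\mathcal P$ over $[n]$, every $0<\varepsilon\le 2$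 and every $\Lambda\in\mathbb N$. If $\mathcal P$ has a (non-tolerant) $(0,\varepsilon)$-tester with $\Lambda$ samples, then for all $0\le\gamma_1<\gamma_2$ with $\gamma_2+\varepsilon<2$ it has a (tolerant) $(\gamma_1,\gamma_2+\varepsilon)$-tester with at most $$\frac{C}{(\gamma_2-\gamma_1)^3}\cdot\min\{\Lambda^2\log^2\Lambda,\;n\}$$ samples, where $\log$ is the natural logarithm and $\Lambda^2\log^2\Lambda$ is read as $0$ for $\Lambda=0$. -/

import Mathlib

namespace DistributionTesting

/-- The `ℓ₁`-distance `∑ i, |D₁ i - D₂ i|` between two distributions over the universe `Fin n`.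
A distribution over `Fin n` is an element of `stdSimplex ℝ (Fin n)`. -/
def l1Dist {n : ℕ} (D₁ D₂ : Fin n → ℝ) : ℝ := ∑ i, |D₁ i - D₂ i|

/-- A distribution property over `Fin n`: a topologically closed set of distributions. (The simplex
is closed, so closed in the simplex and closed in `Fin n → ℝ` mean the same.) -/
def IsDistributionProperty {n : ℕ} (P : Set (Fin n → ℝ)) : Prop :=
  P ⊆ stdSimplex ℝ (Fin n) ∧ IsClosed P

/-- Label-invariance: for every `D ∈ P` and every permutation `σ` of the universe, the relabelled
distribution `D_σ`, with `D_σ i = D (σ⁻¹ i)`, is in `P`. -/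
def IsLabelInvariant {n : ℕ} (P : Set (Fin n → ℝ)) : Prop :=
  ∀ D ∈ P, ∀ σ : Equiv.Perm (Fin n), (fun i => D (σ.symm i)) ∈ P

/-- The distance of `D` from `P`, as an extended real: it is `⊤` for the empty property, and a
minimum for every nonempty property, since properties are compact. -/
noncomputable def distToProperty {n : ℕ} (D : Fin n → ℝ) (P : Set (Fin n → ℝ)) : EReal :=
  ⨅ Q ∈ P, ((l1Dist D Q : ℝ) : EReal)

/-- `D` is `η`-close to `P`. -/
def IsCloseTo {n : ℕ} (η : ℝ) (D : Fin n → ℝ) (P : Set (Fin n → ℝ)) : Prop :=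
  distToProperty D P ≤ (η : EReal)

/-- `D` is `ε`-far from `P`. -/
def IsFarFrom {n : ℕ} (ε : ℝ) (D : Fin n → ℝ) (P : Set (Fin n → ℝ)) : Prop :=
  (ε : EReal) ≤ distToProperty D P

/-- A randomized algorithm that draws `s` samples from the universe `Fin n` and answers
`true` (accept) or `false` (reject). For every sequence of samples, the `PMF` on `Bool` is the law
of the answer over the private coins of the algorithm. -/
abbrev SampleAlgorithm (n s : ℕ) : Type := (Fin s → Fin n) → PMF Bool

/-- The probability that `A` answers `b` when its `s` samples are drawn independently according
to `D`, independently of the private coins. -/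
noncomputable def answerProb {n s : ℕ} (A : SampleAlgorithm n s) (D : Fin n → ℝ) (b : Bool) : ℝ :=
  ∑ x : Fin s → Fin n, (∏ j, D (x j)) * (A x b).toReal

/-- `A` is an `(η, ε)`-tester for `P`: with probability at least `2/3` it accepts each distribution
that is `η`-close to `P`, and with probability at least `2/3` it rejects each distribution that is
`ε`-far from `P`. -/
def IsTester {n s : ℕ} (A : SampleAlgorithm n s) (η ε : ℝ) (P : Set (Fin n → ℝ)) : Prop :=
  ∀ D ∈ stdSimplex ℝ (Fin n),
    (IsCloseTo η D P → 2 / 3 ≤ answerProb A D true) ∧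
    (IsFarFrom ε D P → 2 / 3 ≤ answerProb A D false)

end DistributionTesting

open DistributionTesting

namespace DistributionTesting

/-! By label-invariance, averaging a tester over relabellings makes it see only which samples
coincide. With `Λ` samples, elements of probability at most about `1/Λ²` rarely collide, so two
distributions that agree on all heavier elements are nearly indistinguishable
(`sampleExp_le_of_agree`). If one of them is in the property, the other is therefore not `ε`-far
(`IsTester.not_isFarFrom_of_agree`).

So only the large probabilities need to be learned. A hard cutoff at `τ` is unstable under
estimation, but the soft threshold `max (p - θ) 0` with `θ = δ * τ` is 1-Lipschitz and is learned in
`ℓ₁` from `O(min n (1/θ) / δ²)` samples (`sampleExp_softThreshold_le`). The tolerant tester accepts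
if some distribution near the property has thresholded values near the empirical ones.
`exists_agree_of_softThreshold_close` turns such a witness into a distribution near `D` that differs
from a member of the property only in light elements, which gives soundness
(`exists_tolerant_tester`). The factor `1/θ` supplies the third power of the gap. -/

/-- The expectation of `G x`, where the coordinates of `x` are drawn independently from `D`. -/
noncomputable def sampleExp {n s : ℕ} (D : Fin n → ℝ) (G : (Fin s → Fin n) → ℝ) : ℝ :=
  ∑ x : Fin s → Fin n, (∏ j, D (x j)) * G x

/-! ### Moments of independent samples. -/

section Expectation

variable {n s : ℕ} {D : Fin n → ℝ}

lemma sum_prod_apply {α : Type*} [Fintype α] (φ : Fin s → α → ℝ) :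
    ∑ x : Fin s → α, ∏ j, φ j (x j) = ∏ j, ∑ u, φ j u := by
  classical
  rw [Finset.prod_univ_sum, Fintype.piFinset_univ]

lemma sampleExp_add (G H : (Fin s → Fin n) → ℝ) :
    sampleExp D (fun x => G x + H x) = sampleExp D G + sampleExp D H := by
  simp [sampleExp, mul_add, Finset.sum_add_distrib]

lemma sampleExp_const_mul (c : ℝ) (G : (Fin s → Fin n) → ℝ) :
    sampleExp D (fun x => c * G x) = c * sampleExp D G := by
  simp only [sampleExp, Finset.mul_sum]
  exact Finset.sum_congr rfl fun x _ => by ring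

lemma sampleExp_sum {ι : Type*} (t : Finset ι) (G : ι → (Fin s → Fin n) → ℝ) :
    sampleExp D (fun x => ∑ i ∈ t, G i x) = ∑ i ∈ t, sampleExp D (G i) := by
  simp only [sampleExp, Finset.mul_sum]
  exact Finset.sum_comm

lemma sampleExp_mono (hD : ∀ i, 0 ≤ D i) {G H : (Fin s → Fin n) → ℝ} (h : ∀ x, G x ≤ H x) :
    sampleExp D G ≤ sampleExp D H :=
  Finset.sum_le_sum fun x _ =>
    mul_le_mul_of_nonneg_left (h x) (Finset.prod_nonneg fun _ _ => hD _)

lemma sampleExp_const (hD : D ∈ stdSimplex ℝ (Fin n)) (c : ℝ) :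
    sampleExp (s := s) D (fun _ => c) = c := by
  have h := sum_prod_apply (s := s) (fun _ => D)
  simp only [hD.2, Finset.prod_const_one] at h
  rw [sampleExp, ← Finset.sum_mul, h, one_mul]

lemma sampleExp_apply (hD : D ∈ stdSimplex ℝ (Fin n)) (j : Fin s) (g : Fin n → ℝ) :
    sampleExp D (fun x => g (x j)) = ∑ u, D u * g u := by
  have h := sum_prod_apply (s := s) (fun i u => D u * if i = j then g u else 1)
  rw [Finset.prod_eq_single j] at h
  · simp only [if_true] at h
    rw [← h, sampleExp]
    refine Finset.sum_congr rfl fun x _ => ?_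
    rw [Finset.prod_mul_distrib]
    simp
  · intro i _ hij
    simp [hij, hD.2]
  · simp

lemma sampleExp_apply_mul_apply (hD : D ∈ stdSimplex ℝ (Fin n)) {j k : Fin s} (hjk : j ≠ k)
    (g h : Fin n → ℝ) :
    sampleExp D (fun x => g (x j) * h (x k)) = (∑ u, D u * g u) * ∑ u, D u * h u := by
  have e := sum_prod_apply (s := s)
    (fun i u => D u * ((if i = j then g u else 1) * (if i = k then h u else 1)))
  rw [Finset.prod_eq_mul j k hjk] at e
  · simp only [if_true, hjk, hjk.symm, if_false, one_mul, mul_one] at e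
    rw [← e, sampleExp]
    refine Finset.sum_congr rfl fun x _ => ?_
    rw [Finset.prod_mul_distrib, Finset.prod_mul_distrib]
    simp
  · rintro i _ ⟨hij, hik⟩
    simp [hij, hik, hD.2]
  · simp
  · simp

lemma sampleExp_sq_sum (hD : D ∈ stdSimplex ℝ (Fin n)) (g : Fin n → ℝ)
    (hg : ∑ u, D u * g u = 0) :
    sampleExp D (fun x : Fin s → Fin n => (∑ j, g (x j)) ^ 2) = s * ∑ u, D u * g u ^ 2 := by
  have h1 : ∀ j k : Fin s, sampleExp D (fun x => g (x j) * g (x k)) =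
      if j = k then ∑ u, D u * g u ^ 2 else 0 := by
    intro j k
    split_ifs with h
    · subst h
      simp only [← sq]
      exact sampleExp_apply hD j fun u => g u ^ 2
    · rw [sampleExp_apply_mul_apply hD h, hg, zero_mul]
  simp only [sq (∑ j, g _), Finset.sum_mul_sum, sampleExp_sum, h1]
  simp

/-- The empirical distribution of a sequence of samples. -/
noncomputable def empirical (x : Fin s → Fin n) (i : Fin n) : ℝ :=
  (∑ j, if x j = i then (1 : ℝ) else 0) / s

/-- This is the variance `D i * (1 - D i) / s` of a binomial frequency. -/
lemma sampleExp_empirical_sq (hD : D ∈ stdSimplex ℝ (Fin n)) (hs : 0 < s) (i : Fin n) :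
    sampleExp D (fun x : Fin s → Fin n => (empirical x i - D i) ^ 2) ≤ D i / s := by
  have hs' : (0 : ℝ) < s := by exact_mod_cast hs
  have e : ∀ x : Fin s → Fin n, (empirical x i - D i) ^ 2 =
      (1 / (s : ℝ) ^ 2) * (∑ j, ((if x j = i then (1 : ℝ) else 0) - D i)) ^ 2 := by
    intro x
    rw [Finset.sum_sub_distrib, empirical]
    simp only [Finset.sum_const, Finset.card_univ, Fintype.card_fin, nsmul_eq_mul]
    field_simp
  simp only [e]
  rw [sampleExp_const_mul, sampleExp_sq_sum hD fun u => (if u = i then (1 : ℝ) else 0) - D i]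
  · have h2 : ∑ u, D u * ((if u = i then (1 : ℝ) else 0) - D i) ^ 2 = D i - D i ^ 2 := by
      have : ∀ u, D u * ((if u = i then (1 : ℝ) else 0) - D i) ^ 2 =
          (if u = i then D u * (1 - 2 * D i) else 0) + D u * D i ^ 2 := by
        intro u
        split_ifs <;> ring
      simp only [this, Finset.sum_add_distrib, ← Finset.sum_mul, hD.2]
      simp
      ring
    rw [h2, ← mul_assoc, show 1 / (s : ℝ) ^ 2 * s = 1 / s by field_simp, one_div_mul_eq_div]
    gcongr
    nlinarith [sq_nonneg (D i)]
  · simp [mul_sub, Finset.sum_sub_distrib, ← Finset.sum_mul, hD.2]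

end Expectation

/-! ### Learning the soft-thresholded distribution. -/

section Learning

/-- Soft thresholding is learnable: pointwise bound when the threshold is positive. -/
lemma abs_softThreshold_sub_le_of_pos {θ κ p X : ℝ} (hθ : 0 < θ) (hκ : 0 < κ) (hκ1 : κ ≤ 1)
    (hp : 0 ≤ p) :
    |max (X - θ) 0 - max (p - θ) 0| ≤ κ * p + 1 / θ * (X - p) ^ 2 / (2 * κ) := by
  -- For `p ≤ θ / 2` the error is nonzero only if `X` overshoots `p` by more than `θ / 2`, so the
  -- quadratic term alone pays. Otherwise AM-GM weighted by `p` applies.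
  by_cases h : p ≤ θ / 2
  · rw [max_eq_right (by linarith : p - θ ≤ 0), sub_zero, abs_of_nonneg (le_max_right _ _)]
    have h0 : 0 ≤ 1 / θ * (X - p) ^ 2 / (2 * κ) := by positivity
    refine max_le ?_ (by positivity)
    have h1 : (X - p) ^ 2 / (2 * θ) ≤ 1 / θ * (X - p) ^ 2 / (2 * κ) := by
      rw [one_div_mul_eq_div, div_div]
      exact div_le_div_of_nonneg_left (sq_nonneg _) (by positivity)
        (by nlinarith [mul_le_mul_of_nonneg_left hκ1 hθ.le])
    have h2 : X - p - θ / 2 ≤ (X - p) ^ 2 / (2 * θ) := by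
      rw [le_div_iff₀ (by positivity)]
      nlinarith [sq_nonneg (X - p - θ)]
    nlinarith [mul_nonneg hκ.le hp]
  · have hp' : 0 < p := by linarith
    refine (abs_max_sub_max_le_abs _ _ _).trans ?_
    rw [sub_sub_sub_cancel_right]
    have h1 : (X - p) ^ 2 / (4 * κ * p) ≤ 1 / θ * (X - p) ^ 2 / (2 * κ) := by
      rw [one_div_mul_eq_div, div_div]
      exact div_le_div_of_nonneg_left (sq_nonneg _) (by positivity)
        (by nlinarith [mul_le_mul_of_nonneg_left (not_le.1 h).le hκ.le])
    have h2 : |X - p| ≤ κ * p + (X - p) ^ 2 / (4 * κ * p) := by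
      rw [← sub_le_iff_le_add', le_div_iff₀ (by positivity), ← sq_abs (X - p)]
      nlinarith [sq_nonneg (|X - p| - 2 * (κ * p))]
    linarith

lemma abs_softThreshold_sub_le_of_card {θ κ p X N : ℝ} (hN : 0 < N) (hκ : 0 < κ) :
    |max (X - θ) 0 - max (p - θ) 0| ≤ κ * (1 / N) + N * (X - p) ^ 2 / (2 * κ) := by
  refine (abs_max_sub_max_le_abs _ _ _).trans ?_
  rw [sub_sub_sub_cancel_right, ← sq_abs (X - p)]
  have h2 : |X - p| - κ * (1 / N) ≤ N * |X - p| ^ 2 / (2 * κ) := by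
    rw [le_div_iff₀ (by positivity)]
    have : N * |X - p| ^ 2 - (|X - p| - κ * (1 / N)) * (2 * κ) =
      1 / N * ((N * |X - p| - κ) ^ 2 + κ ^ 2) := by
      field_simp
      ring
    have : 0 ≤ 1 / N * ((N * |X - p| - κ) ^ 2 + κ ^ 2) := by positivity
    linarith
  linarith

lemma sampleExp_softThreshold_le {n s : ℕ} {D : Fin n → ℝ} (hD : D ∈ stdSimplex ℝ (Fin n))
    (hs : 0 < s) (hn : 0 < n) {θ κ : ℝ} (hθ : 0 < θ) (hκ : 0 < κ) (hκ1 : κ ≤ 1) :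
    sampleExp D (fun x : Fin s → Fin n =>
      ∑ i, |max (D i - θ) 0 - max (empirical x i - θ) 0|) ≤
      κ + min (n : ℝ) (1 / θ) / (2 * κ * s) := by
  have hs' : (0 : ℝ) < s := by exact_mod_cast hs
  have hn' : (0 : ℝ) < n := by exact_mod_cast hn
  -- Both bounds have one shape, with error weights of total mass 1: uniform weights give the factor
  -- `n`, the weights `D` give `1 / θ`.
  obtain ⟨w, hw, hb⟩ : ∃ w : Fin n → ℝ, ∑ i, w i = 1 ∧ ∀ i X,
      |max (D i - θ) 0 - max (X - θ) 0| ≤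
        κ * w i + min (n : ℝ) (1 / θ) * (X - D i) ^ 2 / (2 * κ) := by
    rcases min_choice (n : ℝ) (1 / θ) with h | h
    · refine ⟨fun _ => 1 / n, by simp; field_simp, fun i X => ?_⟩
      rw [h, abs_sub_comm]
      exact abs_softThreshold_sub_le_of_card hn' hκ
    · refine ⟨D, hD.2, fun i X => ?_⟩
      rw [h, abs_sub_comm]
      exact abs_softThreshold_sub_le_of_pos hθ hκ hκ1 (hD.1 i)
  set R := min (n : ℝ) (1 / θ) with hR
  have hR0 : 0 < R := lt_min hn' (by positivity)
  have h1 : sampleExp D (fun x : Fin s → Fin n =>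
      ∑ i, |max (D i - θ) 0 - max (empirical x i - θ) 0|) ≤
      sampleExp D (fun x : Fin s → Fin n =>
        ∑ i, (κ * w i + R / (2 * κ) * (empirical x i - D i) ^ 2)) := by
    refine sampleExp_mono hD.1 fun x => Finset.sum_le_sum fun i _ => (hb i _).trans_eq ?_
    ring
  refine h1.trans ?_
  rw [sampleExp_sum]
  calc ∑ i, sampleExp D (fun x : Fin s → Fin n =>
        κ * w i + R / (2 * κ) * (empirical x i - D i) ^ 2)
      ≤ ∑ i, (κ * w i + R / (2 * κ) * (D i / s)) := by
        refine Finset.sum_le_sum fun i _ => ?_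
        rw [sampleExp_add, sampleExp_const hD, sampleExp_const_mul]
        gcongr
        exact sampleExp_empirical_sq hD hs i
    _ = κ + R / (2 * κ * s) := by
        rw [Finset.sum_add_distrib, ← Finset.mul_sum, hw, ← Finset.mul_sum, ← Finset.sum_div, hD.2]
        field_simp

end Learning
-- Light elements are indistinguishable without collisions.
section Coupling

variable {n s : ℕ} {D D' : Fin n → ℝ}

/-- Two sequences with the same kernel differ by a permutation of the universe. -/
lemma exists_perm_comp_eq {α : Type*} [Finite α] {x y : Fin s → α}
    (h : ∀ j k, x j = x k ↔ y j = y k) : ∃ σ : Equiv.Perm α, ∀ j, σ (x j) = y j := by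
  classical
  let f : {a // ∃ j, x j = a} → {a // ∃ j, y j = a} := fun a => ⟨y a.2.choose, _, rfl⟩
  have hf : ∀ j, (f ⟨x j, j, rfl⟩ : α) = y j := fun j =>
    (h _ _).1 (⟨j, rfl⟩ : ∃ k, x k = x j).choose_spec
  have hbij : Function.Bijective f := by
    constructor
    · rintro ⟨_, j, rfl⟩ ⟨_, k, rfl⟩ hjk
      have := congrArg Subtype.val hjk
      rw [hf, hf] at this
      exact Subtype.ext ((h j k).2 this)
    · rintro ⟨_, j, rfl⟩
      exact ⟨⟨x j, j, rfl⟩, Subtype.ext (hf j)⟩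
  refine ⟨(Equiv.ofBijective f hbij).extendSubtype, fun j => ?_⟩
  rw [Equiv.extendSubtype_apply_of_mem _ _ ⟨j, rfl⟩]
  exact hf j

/-- The number of ordered collisions outside of `A`. -/
def collisions (A : Finset (Fin n)) (x : Fin s → Fin n) : ℝ :=
  ∑ p ∈ (Finset.univ : Finset (Fin s)).offDiag, ∑ u ∈ Aᶜ,
    (if x p.1 = u then 1 else 0) * (if x p.2 = u then 1 else 0)

lemma collisions_nonneg (A : Finset (Fin n)) (x : Fin s → Fin n) : 0 ≤ collisions A x :=
  Finset.sum_nonneg fun _ _ => Finset.sum_nonneg fun _ _ => by split_ifs <;> norm_num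

lemma one_le_collisions {A : Finset (Fin n)} {x : Fin s → Fin n} {j k : Fin s} (hjk : j ≠ k)
    (hx : x j = x k) (hA : x j ∉ A) : 1 ≤ collisions A x := by
  have h0 : ∀ (p : Fin s × Fin s) (u : Fin n),
      (0 : ℝ) ≤ (if x p.1 = u then 1 else 0) * (if x p.2 = u then 1 else 0) := by
    intro p u
    split_ifs <;> norm_num
  calc (1 : ℝ) = (if x j = x j then 1 else 0) * (if x k = x j then 1 else 0) := by simp [hx]
    _ ≤ ∑ u ∈ Aᶜ, (if x j = u then 1 else 0) * (if x k = u then 1 else 0) :=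
        Finset.single_le_sum (f := fun u : Fin n =>
          ((if x j = u then 1 else 0) * (if x k = u then 1 else 0) : ℝ))
          (fun u _ => h0 (j, k) u) (by simpa using hA)
    _ ≤ collisions A x :=
        Finset.single_le_sum (f := fun p : Fin s × Fin s => ∑ u ∈ Aᶜ,
          ((if x p.1 = u then 1 else 0) * (if x p.2 = u then 1 else 0) : ℝ))
          (fun p _ => Finset.sum_nonneg fun u _ => h0 p u)
          (by simpa using hjk : (j, k) ∈ (Finset.univ : Finset (Fin s)).offDiag)

/-- Each ordered pair collides outside `A` with probability `∑ D u ^ 2` over `Aᶜ`, which is at most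
`τ`. -/
lemma sampleExp_collisions_le (hD : D ∈ stdSimplex ℝ (Fin n)) {A : Finset (Fin n)} {τ : ℝ}
    (hτ : ∀ i ∉ A, D i ≤ τ) (hτ0 : 0 ≤ τ) :
    sampleExp D (fun x : Fin s → Fin n => collisions A x) ≤ s * (s - 1) * τ := by
  have h1 : ∀ p ∈ (Finset.univ : Finset (Fin s)).offDiag, sampleExp D (fun x : Fin s → Fin n =>
      ∑ u ∈ Aᶜ, (if x p.1 = u then (1 : ℝ) else 0) * (if x p.2 = u then 1 else 0)) ≤ τ := by
    intro p hp
    have hp' : p.1 ≠ p.2 := (Finset.mem_offDiag.1 hp).2.2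
    rw [sampleExp_sum]
    calc _ = ∑ u ∈ Aᶜ, D u * D u := Finset.sum_congr rfl fun u _ => by
            rw [sampleExp_apply_mul_apply hD hp' (fun v => if v = u then (1 : ℝ) else 0)
              (fun v => if v = u then (1 : ℝ) else 0)]
            simp
      _ ≤ ∑ u ∈ Aᶜ, D u * τ := Finset.sum_le_sum fun u hu =>
            mul_le_mul_of_nonneg_left (hτ u (by simpa using hu)) (hD.1 u)
      _ ≤ ∑ u, D u * τ := Finset.sum_le_sum_of_subset_of_nonneg (Finset.subset_univ _)
            fun u _ _ => mul_nonneg (hD.1 u) hτ0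
      _ = τ := by rw [← Finset.sum_mul, hD.2, one_mul]
  unfold collisions
  rw [sampleExp_sum]
  refine (Finset.sum_le_card_nsmul _ _ _ h1).trans_eq ?_
  rw [Finset.offDiag_card, nsmul_eq_mul, Nat.cast_sub (Nat.le_mul_self _)]
  simp only [Finset.card_univ, Fintype.card_fin]
  push_cast
  ring

/-- A coupling of `D` and `D'`, which agree on `A`: equal on `A`, independent outside of `A`. -/
noncomputable def couplingWeight (D D' : Fin n → ℝ) (A : Finset (Fin n)) (u v : Fin n) : ℝ :=
  if u ∈ A then (if u = v then D u else 0)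
  else if v ∈ A then 0 else D u * D' v / ∑ i ∈ Aᶜ, D i

lemma couplingWeight_nonneg (hD : ∀ i, 0 ≤ D i) (hD' : ∀ i, 0 ≤ D' i) (A : Finset (Fin n))
    (u v : Fin n) : 0 ≤ couplingWeight D D' A u v := by
  have := hD u
  have := hD' v
  have := Finset.sum_nonneg fun i (_ : i ∈ Aᶜ) => hD i
  unfold couplingWeight
  split_ifs <;> positivity

lemma sum_compl_eq (hD : D ∈ stdSimplex ℝ (Fin n)) (hD' : D' ∈ stdSimplex ℝ (Fin n))
    {A : Finset (Fin n)} (hA : ∀ i ∈ A, D i = D' i) : ∑ i ∈ Aᶜ, D i = ∑ i ∈ Aᶜ, D' i := by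
  have h1 := Finset.sum_add_sum_compl A D
  have h2 := Finset.sum_add_sum_compl A D'
  rw [hD.2] at h1
  rw [hD'.2] at h2
  have := Finset.sum_congr rfl hA
  linarith

lemma couplingWeight_comm (hD : D ∈ stdSimplex ℝ (Fin n)) (hD' : D' ∈ stdSimplex ℝ (Fin n))
    {A : Finset (Fin n)} (hA : ∀ i ∈ A, D i = D' i) (u v : Fin n) :
    couplingWeight D D' A u v = couplingWeight D' D A v u := by
  unfold couplingWeight
  rw [sum_compl_eq hD hD' hA]
  by_cases hu : u ∈ A <;> by_cases hv : v ∈ A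
  · by_cases h : u = v
    · subst h; simp [hu, hA u hu]
    · simp [hu, hv, h, Ne.symm h]
  · have : u ≠ v := fun h => hv (h ▸ hu)
    simp [hu, hv, this]
  · have : v ≠ u := fun h => hu (h ▸ hv)
    simp [hu, hv, this]
  · simp [hu, hv, mul_comm]

lemma sum_couplingWeight (hD : D ∈ stdSimplex ℝ (Fin n)) (hD' : D' ∈ stdSimplex ℝ (Fin n))
    {A : Finset (Fin n)} (hA : ∀ i ∈ A, D i = D' i) (u : Fin n) :
    ∑ v, couplingWeight D D' A u v = D u := by
  unfold couplingWeight
  by_cases hu : u ∈ A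
  · simp [hu]
  · simp only [hu, if_false]
    rw [← Finset.sum_add_sum_compl A,
      Finset.sum_eq_zero (s := A) fun v hv => by simp [hv], zero_add,
      Finset.sum_congr (s₁ := Aᶜ) rfl fun v hv => if_neg (by simpa using hv),
      ← Finset.sum_div, ← Finset.mul_sum, ← sum_compl_eq hD hD' hA]
    -- With no mass outside `A`, the convention `x / 0 = 0` gives the correct marginal, since `D u =
    -- 0`.
    by_cases h0 : ∑ i ∈ Aᶜ, D i = 0
    · rw [h0, div_zero, (Finset.sum_eq_zero_iff_of_nonneg fun i _ => hD.1 i).1 h0 u (by simpa)]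
    · field_simp

/-- A relabelling-invariant statistic barely distinguishes two distributions that agree on `A` and
have small probabilities outside of `A`. -/
lemma sampleExp_le_of_agree (hD : D ∈ stdSimplex ℝ (Fin n)) (hD' : D' ∈ stdSimplex ℝ (Fin n))
    {A : Finset (Fin n)} (hA : ∀ i ∈ A, D i = D' i) {τ : ℝ} (hτ0 : 0 ≤ τ)
    (hτ : ∀ i ∉ A, D i ≤ τ) (hτ' : ∀ i ∉ A, D' i ≤ τ) {F : (Fin s → Fin n) → ℝ}
    (hF0 : ∀ x, 0 ≤ F x) (hF1 : ∀ x, F x ≤ 1)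
    (hF : ∀ (σ : Equiv.Perm (Fin n)) x, F (fun j => σ (x j)) = F x) :
    sampleExp D F ≤ sampleExp D' F + 2 * (s * (s - 1) * τ) := by
  set W : (Fin s → Fin n) → (Fin s → Fin n) → ℝ :=
    fun x y => ∏ j, couplingWeight D D' A (x j) (y j) with hW
  have hW0 : ∀ x y, 0 ≤ W x y := fun x y =>
    Finset.prod_nonneg fun j _ => couplingWeight_nonneg hD.1 hD'.1 A _ _
  have hL : ∀ G : (Fin s → Fin n) → ℝ, sampleExp D G = ∑ x, ∑ y, W x y * G x := by
    intro G
    refine Finset.sum_congr rfl fun x _ => ?_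
    rw [← Finset.sum_mul, hW, sum_prod_apply fun j v => couplingWeight D D' A (x j) v]
    simp only [sum_couplingWeight hD hD' hA]
  have hR : ∀ G : (Fin s → Fin n) → ℝ, sampleExp D' G = ∑ x, ∑ y, W x y * G y := by
    intro G
    rw [Finset.sum_comm]
    refine Finset.sum_congr rfl fun y _ => ?_
    simp only [hW, couplingWeight_comm hD hD' hA]
    rw [← Finset.sum_mul, sum_prod_apply fun j v => couplingWeight D' D A (y j) v]
    simp only [sum_couplingWeight hD' hD fun i hi => (hA i hi).symm]
  -- A collision outside `A` in either sequence makes the right side at least `F x`. Without one,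
  -- coupled sequences have the same coincidence pattern, so a relabelling carries one to the other.
  have key : ∀ x y, W x y * F x ≤ W x y * (F y + collisions A y + collisions A x) := by
    intro x y
    by_cases hw : W x y = 0
    · simp [hw]
    refine mul_le_mul_of_nonneg_left ?_ (hW0 x y)
    have hcx := collisions_nonneg A x
    have hcy := collisions_nonneg A y
    by_cases hx : 1 ≤ collisions A x
    · linarith [hF0 y, hF1 x]
    by_cases hy : 1 ≤ collisions A y
    · linarith [hF0 y, hF1 x]
    have hc : ∀ j, (x j ∈ A ↔ y j ∈ A) ∧ (x j ∈ A → x j = y j) := by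
      intro j
      have hj : couplingWeight D D' A (x j) (y j) ≠ 0 :=
        (Finset.prod_ne_zero_iff.1 hw) j (Finset.mem_univ j)
      unfold couplingWeight at hj
      by_cases h1 : x j ∈ A
      · by_cases h2 : x j = y j
        · exact ⟨by rw [h2], fun _ => h2⟩
        · simp [h1, h2] at hj
      · by_cases h2 : y j ∈ A
        · simp [h1, h2] at hj
        · simp [h1, h2]
    have hker : ∀ j k, x j = x k ↔ y j = y k := by
      intro j k
      by_cases hjk : j = k
      · simp [hjk]
      constructor
      · intro h
        by_cases hxA : x j ∈ A
        · rw [← (hc j).2 hxA, ← (hc k).2 (h ▸ hxA), h]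
        · exact absurd (one_le_collisions hjk h hxA) hx
      · intro h
        by_cases hyA : y j ∈ A
        · rw [(hc j).2 ((hc j).1.2 hyA), (hc k).2 ((hc k).1.2 (h ▸ hyA)), h]
        · exact absurd (one_le_collisions hjk h hyA) hy
    obtain ⟨σ, hσ⟩ := exists_perm_comp_eq hker
    rw [← hF σ x, funext hσ]
    linarith
  have h1 : sampleExp D F ≤
      sampleExp D' F + sampleExp (s := s) D' (collisions A) +
        sampleExp (s := s) D (collisions A) := by
    rw [hL F, hL (collisions A), hR F, hR (collisions A), ← Finset.sum_add_distrib,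
      ← Finset.sum_add_distrib]
    refine Finset.sum_le_sum fun x _ => ?_
    rw [← Finset.sum_add_distrib, ← Finset.sum_add_distrib]
    refine Finset.sum_le_sum fun y _ => (key x y).trans_eq (by ring)
  have h2 := sampleExp_collisions_le (s := s) hD hτ hτ0
  have h3 := sampleExp_collisions_le (s := s) hD' hτ' hτ0
  linarith

end Coupling

/-! ### Closeness, farness and symmetrized testers. -/

section Properties

variable {n s : ℕ} {P : Set (Fin n → ℝ)}

lemma isFarFrom_iff {ε : ℝ} {D : Fin n → ℝ} :
    IsFarFrom ε D P ↔ ∀ Q ∈ P, ε ≤ l1Dist D Q := by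
  simp [IsFarFrom, distToProperty, le_iInf_iff]

lemma IsCloseTo.exists_lt {η δ : ℝ} {D : Fin n → ℝ} (h : IsCloseTo η D P) (hδ : 0 < δ) :
    ∃ Q ∈ P, l1Dist D Q < η + δ := by
  have h1 : distToProperty D P < ((η + δ : ℝ) : EReal) :=
    lt_of_le_of_lt h (by exact_mod_cast lt_add_of_pos_right η hδ)
  simpa only [distToProperty, iInf_lt_iff, EReal.coe_lt_coe_iff, exists_prop] using h1

lemma isCloseTo_zero_of_mem {D : Fin n → ℝ} (h : D ∈ P) : IsCloseTo 0 D P :=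
  (iInf₂_le D h).trans (by simp [l1Dist])

lemma IsFarFrom.relabel {ε : ℝ} {D : Fin n → ℝ} (hP : IsLabelInvariant P) (h : IsFarFrom ε D P)
    (σ : Equiv.Perm (Fin n)) : IsFarFrom ε (fun i => D (σ.symm i)) P := by
  rw [isFarFrom_iff] at h ⊢
  intro Q hQ
  refine (h _ (hP Q hQ σ.symm)).trans_eq
    (Eq.trans ?_ (Equiv.sum_comp σ fun i => |D (σ.symm i) - Q i|))
  simp [l1Dist]

lemma relabel_mem_stdSimplex {D : Fin n → ℝ} (h : D ∈ stdSimplex ℝ (Fin n))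
    (σ : Equiv.Perm (Fin n)) : (fun i => D (σ.symm i)) ∈ stdSimplex ℝ (Fin n) :=
  ⟨fun _ => h.1 _, (Equiv.sum_comp σ.symm D).trans h.2⟩

lemma toReal_add_toReal (p : PMF Bool) : (p true).toReal + (p false).toReal = 1 := by
  have h := p.tsum_coe
  rw [tsum_bool] at h
  rw [← ENNReal.toReal_add (p.apply_ne_top _) (p.apply_ne_top _), add_comm, h, ENNReal.toReal_one]

lemma answerProb_add (A : SampleAlgorithm n s) {D : Fin n → ℝ} (hD : D ∈ stdSimplex ℝ (Fin n)) :
    answerProb A D true + answerProb A D false = 1 := by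
  have h := sampleExp_add (D := D) (fun x => (A x true).toReal) (fun x => (A x false).toReal)
  simp only [toReal_add_toReal, sampleExp_const hD] at h
  exact h.symm

/-- The probability that `A` accepts `x` after a random relabelling of the universe. -/
noncomputable def symmetrizedAccept (A : SampleAlgorithm n s) (x : Fin s → Fin n) : ℝ :=
  1 / (Fintype.card (Equiv.Perm (Fin n)) : ℝ) *
    ∑ σ : Equiv.Perm (Fin n), (A (fun j => σ (x j)) true).toReal

lemma symmetrizedAccept_perm (A : SampleAlgorithm n s) (π : Equiv.Perm (Fin n))
    (x : Fin s → Fin n) : symmetrizedAccept A (fun j => π (x j)) = symmetrizedAccept A x := by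
  unfold symmetrizedAccept
  congr 1
  exact Equiv.sum_comp (Equiv.mulRight π)
    fun σ : Equiv.Perm (Fin n) => (A (fun j => σ (x j)) true).toReal

lemma symmetrizedAccept_nonneg (A : SampleAlgorithm n s) (x : Fin s → Fin n) :
    0 ≤ symmetrizedAccept A x :=
  mul_nonneg (by positivity) (Finset.sum_nonneg fun _ _ => ENNReal.toReal_nonneg)

lemma symmetrizedAccept_le_one (A : SampleAlgorithm n s) (x : Fin s → Fin n) :
    symmetrizedAccept A x ≤ 1 := by
  have hc : (0 : ℝ) < Fintype.card (Equiv.Perm (Fin n)) := by exact_mod_cast Fintype.card_pos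
  rw [symmetrizedAccept, one_div_mul_eq_div, div_le_one hc]
  refine (Finset.sum_le_card_nsmul _ _ 1 fun σ _ => ?_).trans_eq (by simp)
  linarith [toReal_add_toReal (A fun j => σ (x j)),
    (ENNReal.toReal_nonneg : 0 ≤ (A (fun j => σ (x j)) false).toReal)]

/-- Relabelling the samples is sampling from the relabelled distribution. This transfers the
tester's guarantees to the average, as membership and farness survive relabelling. -/
lemma sampleExp_symmetrizedAccept (A : SampleAlgorithm n s) (D : Fin n → ℝ) :
    sampleExp D (symmetrizedAccept A) = 1 / (Fintype.card (Equiv.Perm (Fin n)) : ℝ) *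
      ∑ σ : Equiv.Perm (Fin n), answerProb A (fun i => D (σ.symm i)) true := by
  unfold symmetrizedAccept
  rw [sampleExp_const_mul, sampleExp_sum]
  congr 1
  refine Finset.sum_congr rfl fun σ _ => ?_
  refine Eq.trans (Finset.sum_congr rfl fun x _ => ?_)
    (Equiv.sum_comp (Equiv.arrowCongr (Equiv.refl (Fin s)) σ)
      fun x => (∏ j, D (σ.symm (x j))) * (A x true).toReal)
  simp [Equiv.arrowCongr, Function.comp_def]

/-- A distribution that agrees with a member of a testable label-invariant property, up to
changing small probabilities, is not far from the property. -/
lemma IsTester.not_isFarFrom_of_agree {ε τ : ℝ} {T : SampleAlgorithm n s} (hT : IsTester T 0 ε P)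
    (hP : IsLabelInvariant P) {Q D : Fin n → ℝ} (hQP : Q ∈ P) (hQ : Q ∈ stdSimplex ℝ (Fin n))
    (hD : D ∈ stdSimplex ℝ (Fin n)) {A : Finset (Fin n)} (hA : ∀ i ∈ A, Q i = D i) (hτ0 : 0 ≤ τ)
    (hQτ : ∀ i ∉ A, Q i ≤ τ) (hDτ : ∀ i ∉ A, D i ≤ τ) (hs : 2 * (s * (s - 1) * τ) < 1 / 3) :
    ¬ IsFarFrom ε D P := by
  intro hfar
  have hc : (0 : ℝ) < Fintype.card (Equiv.Perm (Fin n)) := by exact_mod_cast Fintype.card_pos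
  have h1 : 2 / 3 ≤ sampleExp Q (symmetrizedAccept T) := by
    rw [sampleExp_symmetrizedAccept, one_div_mul_eq_div, le_div_iff₀ hc]
    refine le_trans (le_of_eq ?_) (Finset.card_nsmul_le_sum _ _ (2 / 3) fun σ _ =>
      (hT _ (relabel_mem_stdSimplex hQ σ)).1 (isCloseTo_zero_of_mem (hP Q hQP σ)))
    rw [nsmul_eq_mul, Finset.card_univ, mul_comm]
  have h2 : sampleExp D (symmetrizedAccept T) ≤ 1 / 3 := by
    rw [sampleExp_symmetrizedAccept, one_div_mul_eq_div, div_le_iff₀ hc]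
    refine (Finset.sum_le_card_nsmul _ _ (1 / 3) fun σ _ => ?_).trans (le_of_eq ?_)
    · have h3 := (hT _ (relabel_mem_stdSimplex hD σ)).2 (hfar.relabel hP σ)
      linarith [answerProb_add T (relabel_mem_stdSimplex hD σ)]
    · rw [nsmul_eq_mul, Finset.card_univ, mul_comm]
  linarith [sampleExp_le_of_agree hQ hD hA hτ0 hQτ hDτ (symmetrizedAccept_nonneg T)
    (symmetrizedAccept_le_one T) (symmetrizedAccept_perm T)]

end Properties
-- Replacing light elements at small cost.
section Truncation

/-- A vector with entries in `[0, τ]` can be moved to any feasible total mass, at the least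
possible cost and within the same bounds. -/
lemma exists_rebalance {ι : Type*} (B : Finset ι) {g : ι → ℝ} {τ m : ℝ}
    (hg0 : ∀ i ∈ B, 0 ≤ g i) (hgτ : ∀ i ∈ B, g i ≤ τ) (hm0 : 0 ≤ m) (hmτ : m ≤ ∑ _i ∈ B, τ) :
    ∃ h : ι → ℝ, (∀ i ∈ B, 0 ≤ h i) ∧ (∀ i ∈ B, h i ≤ τ) ∧ ∑ i ∈ B, h i = m ∧
      ∑ i ∈ B, |g i - h i| = |∑ i ∈ B, g i - m| := by
  set S := ∑ i ∈ B, g i with hS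
  rcases eq_or_ne S m with h0 | h0
  · exact ⟨g, hg0, hgτ, h0, by simp [h0]⟩
  rcases lt_or_gt_of_ne h0 with h | h
  -- Every entry moves the same fraction towards `τ` (here) or towards `0` (other case). All changes
  -- share a sign, so the cost is just the change in mass.
  · set U := ∑ i ∈ B, (τ - g i) with hU
    have hU' : U = ∑ _i ∈ B, τ - S := by rw [hU, Finset.sum_sub_distrib]
    have hUpos : 0 < U := by linarith
    set l := (m - S) / U with hl
    have hl0 : 0 ≤ l := div_nonneg (by linarith) hUpos.le
    have hl1 : l ≤ 1 := (div_le_one hUpos).2 (by linarith)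
    have hlU : l * U = m - S := div_mul_cancel₀ _ hUpos.ne'
    have hp : ∀ i ∈ B, 0 ≤ l * (τ - g i) := fun i hi =>
      mul_nonneg hl0 (sub_nonneg.2 (hgτ i hi))
    refine ⟨fun i => g i + l * (τ - g i), fun i hi => add_nonneg (hg0 i hi) (hp i hi),
      fun i hi => ?_, ?_, ?_⟩
    · linarith [mul_le_mul_of_nonneg_right hl1 (sub_nonneg.2 (hgτ i hi))]
    · rw [Finset.sum_add_distrib, ← Finset.mul_sum, ← hU, hlU]
      ring
    · rw [abs_of_neg (by linarith), neg_sub, ← hlU, hU, Finset.mul_sum]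
      refine Finset.sum_congr rfl fun i hi => ?_
      rw [sub_add_cancel_left, abs_neg, abs_of_nonneg (hp i hi)]
  · have hSpos : 0 < S := by linarith
    set l := m / S with hl
    have hl0 : 0 ≤ l := div_nonneg hm0 hSpos.le
    have hl1 : l ≤ 1 := (div_le_one hSpos).2 h.le
    have hlS : l * S = m := div_mul_cancel₀ _ hSpos.ne'
    refine ⟨fun i => l * g i, fun i hi => mul_nonneg hl0 (hg0 i hi), fun i hi => ?_, ?_, ?_⟩
    · exact (mul_le_of_le_one_left (hg0 i hi) hl1).trans (hgτ i hi)
    · rw [← Finset.mul_sum, ← hS, hlS]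
    · rw [abs_of_pos (by linarith), ← hlS, hS, Finset.mul_sum, ← Finset.sum_sub_distrib]
      refine Finset.sum_congr rfl fun i hi => abs_of_nonneg ?_
      linarith [mul_le_of_le_one_left (hg0 i hi) hl1]

variable {n : ℕ}

/-- What thresholding removes, `min x θ`, lies in `[0, θ]`. -/
lemma abs_sub_le_softThreshold {x y θ : ℝ} (hx : 0 ≤ x) (hy : 0 ≤ y) (hθ : 0 ≤ θ) :
    |x - y| ≤ |max (x - θ) 0 - max (y - θ) 0| + θ := by
  rcases max_cases (x - θ) 0 with ⟨h1, h1'⟩ | ⟨h1, h1'⟩ <;>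
  rcases max_cases (y - θ) 0 with ⟨h2, h2'⟩ | ⟨h2, h2'⟩ <;>
  rw [h1, h2] <;> rw [abs_le] <;> constructor <;>
  linarith [le_abs_self (x - θ - (y - θ)), neg_abs_le (x - θ - (y - θ)),
    le_abs_self (x - θ - 0), neg_abs_le (x - θ - 0), le_abs_self (0 - (y - θ)),
    neg_abs_le (0 - (y - θ)), abs_nonneg ((0 : ℝ) - 0)]

/-- Thresholding at `τ` is thresholding at `θ` and then at `τ - θ`, and the latter is 1-Lipschitz.
-/
lemma softThreshold_le_add {x y θ τ : ℝ} (hθτ : θ ≤ τ) :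
    max (x - τ) 0 ≤ max (y - τ) 0 + |max (x - θ) 0 - max (y - θ) 0| := by
  have e : ∀ z : ℝ, max (z - τ) 0 = max (max (z - θ) 0 - (τ - θ)) 0 := by
    intro z
    rcases max_cases (z - θ) 0 with ⟨h1, h1'⟩ | ⟨h1, h1'⟩ <;> rw [h1]
    · congr 1
      ring
    · rw [max_eq_right (by linarith), max_eq_right (by linarith)]
  have h := abs_max_sub_max_le_abs (max (x - θ) 0 - (τ - θ)) (max (y - θ) 0 - (τ - θ)) 0
  rw [← e, ← e, sub_sub_sub_cancel_right] at h
  linarith [le_abs_self (max (x - τ) 0 - max (y - τ) 0)]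

lemma max_sub_eq_sub_min (x τ : ℝ) : max (x - τ) 0 = x - min x τ := by
  rcases le_total x τ with h | h
  · rw [max_eq_right (by linarith), min_eq_left h, sub_self]
  · rw [max_eq_left (by linarith), min_eq_right h]

/-- If the large probabilities of `D` are close to those of `D₁`, and `D₁` is close to `Q`, then `D`
is close to a distribution which differs from `Q` only in its small probabilities. -/
lemma exists_agree_of_softThreshold_close {D D₁ Q : Fin n → ℝ} (hD : D ∈ stdSimplex ℝ (Fin n))
    (hD₁ : D₁ ∈ stdSimplex ℝ (Fin n)) (hQ : Q ∈ stdSimplex ℝ (Fin n)) {θ τ δ γ β : ℝ}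
    (hθ : 0 ≤ θ) (hτ : 0 < τ) (hδ1 : δ ≤ 1) (hθδ : θ = δ * τ) (hγ : l1Dist D₁ Q ≤ γ)
    (hβ : ∑ i, |max (D i - θ) 0 - max (D₁ i - θ) 0| ≤ β) :
    ∃ (A : Finset (Fin n)) (D₂ : Fin n → ℝ), D₂ ∈ stdSimplex ℝ (Fin n) ∧
      (∀ i ∈ A, Q i = D₂ i) ∧ (∀ i ∉ A, Q i ≤ τ) ∧ (∀ i ∉ A, D₂ i ≤ τ) ∧
      l1Dist D D₂ ≤ γ + 2 * (β + δ) := by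
  classical
  have hθτ : θ ≤ τ := hθδ ▸ mul_le_of_le_one_left hτ.le hδ1
  set A : Finset (Fin n) := Finset.univ.filter fun i => τ < Q i with hAdef
  have hQA : ∀ i ∉ A, Q i ≤ τ := fun i hi => by simpa [hAdef] using hi
  -- At most `1 / τ` elements are heavy, so losing `θ` on each costs at most `δ` in total.
  have hcard : A.card * θ ≤ δ := by
    have h1 : A.card • τ ≤ ∑ i ∈ A, Q i :=
      Finset.card_nsmul_le_sum _ _ _ fun i hi => (Finset.mem_filter.1 hi).2.le
    have h2 : ∑ i ∈ A, Q i ≤ 1 := hQ.2 ▸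
      Finset.sum_le_sum_of_subset_of_nonneg (Finset.subset_univ _) fun i _ _ => hQ.1 i
    rw [nsmul_eq_mul] at h1
    have hδ0 : 0 ≤ δ := by
      by_contra hneg
      nlinarith
    calc A.card * θ = δ * (A.card * τ) := by rw [hθδ]; ring
      _ ≤ δ * 1 := mul_le_mul_of_nonneg_left (h1.trans h2) hδ0
      _ = δ := mul_one δ
  set g : Fin n → ℝ := fun i => min (D i) τ with hg
  set m := ∑ i ∈ Aᶜ, Q i with hm
  -- The new distribution is `Q` on `A`; off `A` it is `D` capped at `τ`, rebalanced to the mass of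
  -- `Q` there.
  obtain ⟨h, h0, hhτ, hhm, hhd⟩ := exists_rebalance Aᶜ (g := g) (τ := τ) (m := m)
    (fun i _ => le_min (hD.1 i) hτ.le) (fun i _ => min_le_right _ _)
    (Finset.sum_nonneg fun i _ => hQ.1 i)
    (Finset.sum_le_sum fun i hi => hQA i (by simpa using hi))
  refine ⟨A, fun i => if i ∈ A then Q i else h i, ⟨fun i => ?_, ?_⟩, fun i hi => by simp [hi], hQA,
    fun i hi => by simpa [hi] using hhτ i (by simpa using hi), ?_⟩
  · by_cases hi : i ∈ A
    · simpa [hi] using hQ.1 i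
    · simpa [hi] using h0 i (by simpa using hi)
  · rw [← Finset.sum_add_sum_compl A, Finset.sum_congr rfl fun i hi => if_pos hi,
      Finset.sum_congr (s₁ := Aᶜ) rfl fun i hi => if_neg (by simpa using hi), hhm, hm,
      Finset.sum_add_sum_compl, hQ.2]
  set b := fun i => |max (D i - θ) 0 - max (D₁ i - θ) 0| with hb
  have hbA : ∑ i ∈ A, b i + ∑ i ∈ Aᶜ, b i ≤ β := (Finset.sum_add_sum_compl A b).trans_le hβ
  have hγA : ∑ i ∈ A, |D₁ i - Q i| + ∑ i ∈ Aᶜ, |D₁ i - Q i| ≤ γ :=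
    (Finset.sum_add_sum_compl A _).trans_le hγ
  have hdist : l1Dist D (fun i => if i ∈ A then Q i else h i) ≤
      ∑ i ∈ A, |D i - Q i| + ∑ i ∈ Aᶜ, max (D i - τ) 0 + |∑ i ∈ Aᶜ, g i - m| := by
    rw [l1Dist, ← Finset.sum_add_sum_compl A, ← hhd, add_assoc, ← Finset.sum_add_distrib]
    refine add_le_add (Finset.sum_le_sum fun i hi => by simp [hi])
      (Finset.sum_le_sum fun i hi => ?_)
    rw [if_neg (by simpa using hi), max_sub_eq_sub_min,
      ← abs_of_nonneg (sub_nonneg.2 (min_le_left (D i) τ))]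
    exact abs_sub_le _ _ _
  have hDD₁ : ∑ i ∈ A, |D i - D₁ i| ≤ ∑ i ∈ A, b i + δ := by
    refine (Finset.sum_le_sum fun i _ =>
      abs_sub_le_softThreshold (hD.1 i) (hD₁.1 i) hθ).trans ?_
    rw [Finset.sum_add_distrib, Finset.sum_const, nsmul_eq_mul]
    linarith
  have hhigh : ∑ i ∈ A, |D i - Q i| ≤ ∑ i ∈ A, |D i - D₁ i| + ∑ i ∈ A, |D₁ i - Q i| := by
    rw [← Finset.sum_add_distrib]
    exact Finset.sum_le_sum fun i _ => abs_sub_le _ _ _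
  set t := ∑ i ∈ Aᶜ, max (D i - τ) 0 with ht
  set t₁ := ∑ i ∈ Aᶜ, max (D₁ i - τ) 0 with ht₁
  have htt : t ≤ t₁ + ∑ i ∈ Aᶜ, b i := by
    rw [ht, ht₁, ← Finset.sum_add_distrib]
    exact Finset.sum_le_sum fun i _ => softThreshold_le_add hθτ
  have htt' : t₁ ≤ t + ∑ i ∈ Aᶜ, b i := by
    rw [ht, ht₁, ← Finset.sum_add_distrib]
    refine Finset.sum_le_sum fun i _ => ?_
    rw [hb]
    dsimp only
    rw [abs_sub_comm]
    exact softThreshold_le_add hθτ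
  set g₁ : Fin n → ℝ := fun i => min (D₁ i) τ with hg₁
  -- The thresholds do not control `D - D₁` entrywise on light elements. Only the capped mass is
  -- compared, through its complement.
  have hmass : ∀ E : Fin n → ℝ, E ∈ stdSimplex ℝ (Fin n) →
      ∑ i ∈ Aᶜ, min (E i) τ = 1 - ∑ i ∈ A, E i - ∑ i ∈ Aᶜ, max (E i - τ) 0 := by
    intro E hE
    simp only [max_sub_eq_sub_min, Finset.sum_sub_distrib]
    linarith [Finset.sum_add_sum_compl A E, hE.2]
  have hlow : |∑ i ∈ Aᶜ, g i - m| ≤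
      |∑ i ∈ Aᶜ, g₁ i - m| + ∑ i ∈ A, |D i - D₁ i| + ∑ i ∈ Aᶜ, b i := by
    have h1 : |∑ i ∈ Aᶜ, g i - ∑ i ∈ Aᶜ, g₁ i| ≤ ∑ i ∈ A, |D i - D₁ i| + ∑ i ∈ Aᶜ, b i := by
      rw [hg, hg₁, hmass D hD, hmass D₁ hD₁, ← ht, ← ht₁]
      have h2 : |∑ i ∈ A, D i - ∑ i ∈ A, D₁ i| ≤ ∑ i ∈ A, |D i - D₁ i| := by
        rw [← Finset.sum_sub_distrib]
        exact Finset.abs_sum_le_sum_abs _ _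
      rw [abs_le] at h2 ⊢
      constructor <;> linarith [h2.1, h2.2]
    linarith [abs_sub_le (∑ i ∈ Aᶜ, g i) (∑ i ∈ Aᶜ, g₁ i) m]
  -- Off `A`, `Q ≤ τ`, so capping `D₁` at `τ` moves it straight towards `Q` and wastes nothing.
  have hfin : t₁ + |∑ i ∈ Aᶜ, g₁ i - m| ≤ ∑ i ∈ Aᶜ, |D₁ i - Q i| := by
    have h1 : |∑ i ∈ Aᶜ, g₁ i - m| ≤ ∑ i ∈ Aᶜ, |g₁ i - Q i| := by
      rw [hm, ← Finset.sum_sub_distrib]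
      exact Finset.abs_sum_le_sum_abs _ _
    have h2 : t₁ + ∑ i ∈ Aᶜ, |g₁ i - Q i| ≤ ∑ i ∈ Aᶜ, |D₁ i - Q i| := by
      rw [ht₁, ← Finset.sum_add_distrib]
      refine Finset.sum_le_sum fun i hi => ?_
      have hQi := hQA i (by simpa using hi)
      rcases le_total (D₁ i) τ with h3 | h3
      · rw [max_eq_right (by linarith), hg₁]
        simp [h3]
      · rw [max_eq_left (by linarith), hg₁]
        simp only [min_eq_right h3]
        rw [abs_of_nonneg (by linarith), abs_of_nonneg (by linarith)]
        linarith
    linarith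
  linarith

end Truncation

/-! ### The tolerant tester. -/

section Tester

variable {n s : ℕ} {P : Set (Fin n → ℝ)}

lemma answerProb_ite_true {D : Fin n → ℝ} (p : (Fin s → Fin n) → Prop) [DecidablePred p] :
    answerProb (fun x => PMF.pure (decide (p x))) D true =
      sampleExp D (fun x => if p x then (1 : ℝ) else 0) := by
  refine Finset.sum_congr rfl fun x _ => ?_
  by_cases h : p x <;> simp [h, PMF.pure_apply]

lemma answerProb_ite_false {D : Fin n → ℝ} (p : (Fin s → Fin n) → Prop) [DecidablePred p] :
    answerProb (fun x => PMF.pure (decide (p x))) D false =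
      sampleExp D (fun x => if p x then (0 : ℝ) else 1) := by
  refine Finset.sum_congr rfl fun x _ => ?_
  by_cases h : p x <;> simp [h, PMF.pure_apply]

/-- Markov's inequality: `Z` exceeds `δ` with probability at most `1/3`. -/
lemma two_thirds_le_sampleExp {D : Fin n → ℝ} (hD : D ∈ stdSimplex ℝ (Fin n)) {δ : ℝ} (hδ : 0 < δ)
    {Z G : (Fin s → Fin n) → ℝ} (hZ0 : ∀ x, 0 ≤ Z x) (hZ : sampleExp D Z ≤ δ / 3)
    (hG0 : ∀ x, 0 ≤ G x) (hG : ∀ x, Z x ≤ δ → G x = 1) : 2 / 3 ≤ sampleExp D G := by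
  have h1 : sampleExp D (fun _ : Fin s → Fin n => (1 : ℝ)) ≤
      sampleExp D (fun x => G x + δ⁻¹ * Z x) := by
    refine sampleExp_mono hD.1 fun x => ?_
    by_cases h : Z x ≤ δ
    · rw [hG x h]
      have := mul_nonneg (inv_pos.2 hδ).le (hZ0 x)
      linarith
    · have : 1 ≤ δ⁻¹ * Z x := by
        rw [inv_mul_eq_div, le_div_iff₀ hδ]
        linarith
      linarith [hG0 x]
  rw [sampleExp_const hD, sampleExp_add, sampleExp_const_mul] at h1
  have h2 : δ⁻¹ * sampleExp D Z ≤ δ⁻¹ * (δ / 3) :=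
    mul_le_mul_of_nonneg_left hZ (inv_pos.2 hδ).le
  have h3 : δ⁻¹ * (δ / 3) = 1 / 3 := by field_simp
  linarith

/-- The tolerant tester: learn the large probabilities, and accept if they are compatible with
a distribution close to the property. -/
lemma exists_tolerant_tester {Λ : ℕ} {ε δ τ γ : ℝ} {T : SampleAlgorithm n Λ}
    (hT : IsTester T 0 ε P) (hPs : P ⊆ stdSimplex ℝ (Fin n)) (hP : IsLabelInvariant P)
    (hn : 0 < n) (hs : 0 < s) (hδ : 0 < δ) (hδ1 : δ ≤ 1) (hτ : 0 < τ)
    (hΛ : 2 * (Λ * (Λ - 1) * τ) < 1 / 3)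
    (hsize : 18 * min (n : ℝ) (1 / (δ * τ)) / δ ^ 2 ≤ s) :
    ∃ B : SampleAlgorithm n s, IsTester B γ (γ + 7 * δ + ε) P := by
  classical
  have hs' : (0 : ℝ) < s := by exact_mod_cast hs
  set θ := δ * τ with hθdef
  have hθ : 0 < θ := mul_pos hδ hτ
  set Z : (Fin n → ℝ) → (Fin s → Fin n) → ℝ := fun D x =>
    ∑ i, |max (D i - θ) 0 - max (empirical x i - θ) 0| with hZ
  have hZ0 : ∀ D x, 0 ≤ Z D x := fun D x => Finset.sum_nonneg fun i _ => abs_nonneg _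
  have hlearn : ∀ D ∈ stdSimplex ℝ (Fin n), sampleExp D (Z D) ≤ δ / 3 := by
    intro D hD
    -- With `κ = δ / 6` both error terms are at most `δ / 6`; this is the source of the 18 in
    -- `hsize`.
    refine (sampleExp_softThreshold_le hD hs hn hθ (κ := δ / 6) (by positivity)
      (by linarith)).trans ?_
    rw [div_le_iff₀ (by positivity)] at hsize
    have : min (n : ℝ) (1 / θ) / (2 * (δ / 6) * s) ≤ δ / 6 := by
      rw [div_le_iff₀ (by positivity)]
      nlinarith
    linarith
  let acc : (Fin s → Fin n) → Prop := fun x => ∃ Q ∈ P, ∃ D₁ ∈ stdSimplex ℝ (Fin n),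
    l1Dist D₁ Q ≤ γ + δ ∧ Z D₁ x ≤ δ
  refine ⟨fun x => PMF.pure (decide (acc x)), fun D hD => ⟨fun hclose => ?_, fun hfar => ?_⟩⟩
  · rw [answerProb_ite_true]
    obtain ⟨Q, hQ, hDQ⟩ := hclose.exists_lt hδ
    refine two_thirds_le_sampleExp hD hδ (hZ0 D) (hlearn D hD)
      (fun x => by split_ifs <;> norm_num) fun x hx => if_pos ?_
    exact ⟨Q, hQ, D, hD, hDQ.le, hx⟩
  · rw [answerProb_ite_false]
    refine two_thirds_le_sampleExp hD hδ (hZ0 D) (hlearn D hD)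
      (fun x => by split_ifs <;> norm_num) fun x hx => if_neg ?_
    rintro ⟨Q, hQ, D₁, hD₁, hD₁Q, hx₁⟩
    have hβ : ∑ i, |max (D i - θ) 0 - max (D₁ i - θ) 0| ≤ 2 * δ := by
      have h1 : ∑ i, |max (D i - θ) 0 - max (D₁ i - θ) 0| ≤ Z D x + Z D₁ x := by
        rw [hZ]
        dsimp only
        rw [← Finset.sum_add_distrib]
        refine Finset.sum_le_sum fun i _ => ?_
        rw [abs_sub_comm (max (D₁ i - θ) 0)]
        exact abs_sub_le _ _ _
      linarith
    -- The distance is at most `(γ + δ) + 2 * (2 * δ + δ) = γ + 7 * δ`.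
    obtain ⟨A, D₂, hD₂, hA, hQA, hDA, hdist⟩ := exists_agree_of_softThreshold_close hD hD₁
      (hPs hQ) hθ.le hτ hδ1 hθdef hD₁Q hβ
    refine hT.not_isFarFrom_of_agree hP hQ (hPs hQ) hD₂ hA hτ.le hQA hDA hΛ ?_
    rw [isFarFrom_iff] at hfar ⊢
    intro R hR
    have h2 : l1Dist D R ≤ l1Dist D D₂ + l1Dist D₂ R := by
      rw [l1Dist, l1Dist, l1Dist, ← Finset.sum_add_distrib]
      exact Finset.sum_le_sum fun i _ => abs_sub_le _ _ _
    linarith [hfar R hR]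

/-- A label-invariant property with a tester that sees at most one sample is trivial. -/
lemma exists_tester_zero_samples {Λ : ℕ} {ε η ε' : ℝ} {T : SampleAlgorithm n Λ}
    (hT : IsTester T 0 ε P) (hPs : P ⊆ stdSimplex ℝ (Fin n)) (hP : IsLabelInvariant P)
    (hΛ : Λ ≤ 1) (hε : ε ≤ ε') : ∃ B : SampleAlgorithm n 0, IsTester B η ε' P := by
  classical
  refine ⟨fun _ => PMF.pure (decide P.Nonempty), fun D hD => ⟨fun hclose => ?_, fun hfar => ?_⟩⟩
  · obtain ⟨Q, hQ, -⟩ := hclose.exists_lt one_pos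
    rw [answerProb_ite_true, if_pos ⟨Q, hQ⟩, sampleExp_const hD]
    norm_num
  · have hne : ¬ P.Nonempty := by
      rintro ⟨Q, hQ⟩
      have hle : ∀ E ∈ stdSimplex ℝ (Fin n), ∀ i ∉ (∅ : Finset (Fin n)), E i ≤ 1 := fun E hE i _ =>
        hE.2 ▸ Finset.single_le_sum (f := E) (fun j _ => hE.1 j) (Finset.mem_univ i)
      -- One sample cannot collide: `Λ * (Λ - 1) = 0`, so even `τ = 1` is allowed.
      refine hT.not_isFarFrom_of_agree hP hQ (hPs hQ) hD (A := ∅) (by simp) zero_le_one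
        (hle Q (hPs hQ)) (hle D hD) ?_ (le_trans (by exact_mod_cast hε) hfar)
      interval_cases Λ <;> norm_num
    rw [answerProb_ite_false, if_neg hne, sampleExp_const hD]
    norm_num

end Tester

end DistributionTesting

/-! ### Choice of parameters. -/

theorem mainTheorem1 :
    ∃ C : ℝ, 0 < C ∧
      ∀ (n : ℕ) (P : Set (Fin n → ℝ)), IsDistributionProperty P → IsLabelInvariant P →
      ∀ (ε : ℝ), 0 < ε → ε ≤ 2 →
      ∀ (Λ : ℕ), (∃ A : SampleAlgorithm n Λ, IsTester A 0 ε P) →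
      ∀ (γ₁ γ₂ : ℝ), 0 ≤ γ₁ → γ₁ < γ₂ → γ₂ + ε < 2 →
      ∃ s : ℕ,
        (s : ℝ) ≤ C * (1 / (γ₂ - γ₁) ^ 3 * min ((Λ : ℝ) ^ 2 * Real.log (Λ : ℝ) ^ 2) (n : ℝ)) ∧
        ∃ B : SampleAlgorithm n s, IsTester B γ₁ (γ₂ + ε) P := by
  refine ⟨300000, by norm_num, fun n P hPd hP ε hε hε2 Λ ⟨T, hT⟩ γ₁ γ₂ hγ₁ hγ hγε => ?_⟩
  have hgap : 0 < γ₂ - γ₁ := sub_pos.2 hγ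
  by_cases hΛ : Λ ≤ 1
  · refine ⟨0, ?_, exists_tester_zero_samples hT hPd.1 hP hΛ (by linarith)⟩
    have : 0 ≤ min ((Λ : ℝ) ^ 2 * Real.log (Λ : ℝ) ^ 2) (n : ℝ) :=
      le_min (by positivity) (by positivity)
    rw [Nat.cast_zero]
    positivity
  rcases Nat.eq_zero_or_pos n with rfl | hn
  · refine ⟨0, ?_, fun _ => PMF.pure true, fun D hD => absurd hD.2 (by simp)⟩
    have : 0 ≤ min ((Λ : ℝ) ^ 2 * Real.log (Λ : ℝ) ^ 2) ((0 : ℕ) : ℝ) :=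
      le_min (by positivity) (by positivity)
    rw [Nat.cast_zero] at this ⊢
    positivity
  have hΛ2 : (2 : ℝ) ≤ Λ := by exact_mod_cast not_le.1 hΛ
  have hn1 : (1 : ℝ) ≤ n := by exact_mod_cast hn
  obtain ⟨δ, hδ⟩ : ∃ δ, δ = (γ₂ - γ₁) / 7 := ⟨_, rfl⟩
  have hγδ : γ₂ - γ₁ = 7 * δ := by linarith
  have hδ0 : 0 < δ := by rw [hδ]; positivity
  have hδ1 : δ ≤ 1 := by linarith
  -- This makes `2 * Λ * (Λ - 1) * τ` less than `1/4`.
  obtain ⟨τ, hτ⟩ : ∃ τ : ℝ, τ = 1 / (8 * (Λ : ℝ) ^ 2) := ⟨_, rfl⟩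
  have hτ0 : 0 < τ := by rw [hτ]; positivity
  obtain ⟨R, hR⟩ : ∃ R, R = min (n : ℝ) (1 / (δ * τ)) := ⟨_, rfl⟩
  have hRτ : 1 / (δ * τ) = 8 * (Λ : ℝ) ^ 2 / δ := by
    rw [hτ]
    field_simp
  have hR1 : 1 ≤ R := by
    rw [hR, hRτ]
    refine le_min hn1 ?_
    rw [le_div_iff₀ hδ0]
    nlinarith
  have hone : 1 ≤ 18 * R / δ ^ 2 := by
    rw [le_div_iff₀ (by positivity)]
    nlinarith
  refine ⟨⌈18 * R / δ ^ 2⌉₊, ?_, ?_⟩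
  · have h1 : (⌈18 * R / δ ^ 2⌉₊ : ℝ) ≤ 36 * R / δ ^ 2 := by
      have := (Nat.ceil_lt_add_one (zero_le_one.trans hone)).le
      have e : 36 * R / δ ^ 2 = 18 * R / δ ^ 2 + 18 * R / δ ^ 2 := by ring
      linarith
    -- The construction needs no logarithm; it is only bounded below to reach the stated form.
    have hlog : (1 : ℝ) ≤ 3 * Real.log Λ ^ 2 := by
      have h2 := Real.log_le_log two_pos hΛ2
      have h3 := Real.log_two_gt_d9
      nlinarith
    obtain ⟨M, hM⟩ : ∃ M, M = min ((Λ : ℝ) ^ 2 * Real.log (Λ : ℝ) ^ 2) (n : ℝ) := ⟨_, rfl⟩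
    have hRM : R ≤ 24 * M / δ := by
      rw [hR, hRτ, hM, le_div_iff₀ hδ0]
      rcases min_choice ((Λ : ℝ) ^ 2 * Real.log (Λ : ℝ) ^ 2) (n : ℝ) with h | h <;> rw [h]
      · refine (mul_le_mul_of_nonneg_right (min_le_right _ _) hδ0.le).trans ?_
        rw [div_mul_cancel₀ _ hδ0.ne']
        nlinarith [mul_le_mul_of_nonneg_left hlog (sq_nonneg (Λ : ℝ))]
      · refine (mul_le_mul_of_nonneg_right (min_le_left _ _) hδ0.le).trans ?_
        nlinarith
    rw [← hM, hγδ]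
    calc (⌈18 * R / δ ^ 2⌉₊ : ℝ) ≤ 36 * R / δ ^ 2 := h1
      _ ≤ 36 * (24 * M / δ) / δ ^ 2 := by gcongr
      _ = 296352 * (1 / (7 * δ) ^ 3 * M) := by
        field_simp
        ring
      _ ≤ 300000 * (1 / (7 * δ) ^ 3 * M) := by
        have : 0 ≤ M := hM ▸ le_min (by positivity) (by positivity)
        gcongr
        norm_num
  · have h := exists_tolerant_tester (γ := γ₁) (s := ⌈18 * R / δ ^ 2⌉₊) hT hPd.1 hP hn
      (Nat.ceil_pos.2 (by linarith)) hδ0 hδ1 hτ0 ?_ (hR ▸ Nat.le_ceil _)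
    · rwa [← hγδ, add_sub_cancel] at h
    · rw [hτ, mul_one_div, ← mul_div_assoc, div_lt_iff₀ (by positivity)]
      nlinarith
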